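/- Write $\mathbb R_+=[0,\infty)$ and let $\mathcal F(\mathbb R_+)$ be the space of closed subsets of $\mathbb R_+$ with the Borel $\sigma$-algebra of the Fell topology. Let $\alpha>0$ and $\beta\in(0,1)$, and let $P_{R^{(\beta)}}$ be the law on $\mathcal F(\mathbb R_+)$ of a $\beta$-stable regenerative set, i.e. of the closure of the range of a strictly $\beta$-stable subordinator (a subordinator with Laplace exponent $c\lambda^\beta$, $c>0$). Let $(U_j,V_j,R_j)_{j\in\mathbb N}$ be a measurable enumeration of the points of a Poisson point process on $\mathbb R_+\times\mathbb R_+\times\mathcal F(\mathbb R_+)$ with mean measure $$\alpha u^{-(1+\alpha)}\,du\;(1-\beta)v^{-\beta}\,dv\;dP_{R^{(\beta)}},$$ and define $$\eta^{\alpha,\beta}(t)=\sum_{j=1}^\infty U_j\mathbf 1_{\{t\in V_j+R_j\}},\quad t\in\mathbb R_+,\qquad \eta^{\alpha,\beta}(G)=\sup_{t\in G}\eta^{\alpha,\beta}(t),\quad G\subset\mathbb R_+\text{ open}.$$ Then $$x^\alpha\,\mathbb P\bigl(\eta^{\alpha,\beta}((0,1))>x\bigr)\to 1\qquad\text{as }x\to\infty.$$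 In particular, the tail of $\eta^{\alpha,\beta}((0,1))$ is regularly varying with index $-\alpha$: for every $c>0$, $\mathbb P(\eta^{\alpha,\beta}((0,1))>cx)/\mathbb P(\eta^{\alpha,\beta}((0,1))>x)\to c^{-\alpha}$ as $x\to\infty$. -/

import Mathlib

open MeasureTheory ProbabilityTheory Filter Set
open scoped NNReal ENNReal Topology

noncomputable section

/-- The space `F(ℝ₊)` of closed subsets of `ℝ₊ = [0, ∞)`. -/
structure ClosedSubset where
  /-- the underlying set -/
  carrier : Set ℝ≥0
  isClosed : IsClosed carrier

namespace ClosedSubset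

/-- The Fell topology, generated by `{F | F ∩ G ≠ ∅}`, `G` open, and `{F | F ∩ K = ∅}`,
`K` compact. -/
instance instTopologicalSpace : TopologicalSpace ClosedSubset :=
  TopologicalSpace.generateFrom
    ({A | ∃ G : Set ℝ≥0, IsOpen G ∧ A = {F | (F.carrier ∩ G).Nonempty}} ∪
      {A | ∃ K : Set ℝ≥0, IsCompact K ∧ A = {F | F.carrier ∩ K = ∅}})

instance instMeasurableSpace : MeasurableSpace ClosedSubset := borel ClosedSubset

instance instBorelSpace : BorelSpace ClosedSubset := ⟨rfl⟩

/-- The closure of the range of a path `f : ℝ₊ → ℝ₊`. -/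
def closureRange (f : ℝ≥0 → ℝ≥0) : ClosedSubset := ⟨closure (range f), isClosed_closure⟩

end ClosedSubset

/-- `σ` is a (strictly) `β`-stable subordinator under `P`: a process started at `0` with
nondecreasing right-continuous paths and stationary independent increments, whose Laplace
exponent is `c * l ^ β` for some constant `c > 0`. -/
structure IsStableSubordinator {Ω : Type*} [MeasurableSpace Ω] (β : ℝ)
    (σ : ℝ≥0 → Ω → ℝ≥0) (P : Measure Ω) : Prop where
  measurable : ∀ t, Measurable (σ t)
  zero : ∀ ω, σ 0 ω = 0
  monotone : ∀ ω, Monotone fun t => σ t ω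
  rightContinuous : ∀ ω t, ContinuousWithinAt (fun s => σ s ω) (Ici t) t
  indepIncrements : HasIndepIncrements σ P
  stationaryIncrements : ∀ s t, IdentDistrib (fun ω => σ (s + t) ω - σ s ω) (σ t) P P
  laplace : ∃ c : ℝ, 0 < c ∧ ∀ t l : ℝ≥0,
    ∫ ω, Real.exp (-((l : ℝ) * (σ t ω : ℝ))) ∂P = Real.exp (-(c * t * (l : ℝ) ^ β))

/-- `ν` is the law on `F(ℝ₊)` of a `β`-stable regenerative set, that is, of the closure of the
range of a `β`-stable subordinator. -/
def IsStableRegenerativeLaw (β : ℝ) (ν : Measure ClosedSubset) : Prop :=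
  ∃ (Ω : Type) (_ : MeasurableSpace Ω) (P : Measure Ω) (σ : ℝ≥0 → Ω → ℝ≥0),
    IsProbabilityMeasure P ∧ IsStableSubordinator β σ P ∧
      HasLaw (fun ω => ClosedSubset.closureRange fun t => σ t ω) ν P

/-- The number of indices `j` with `X j ω ∈ B`. -/
def pointCount {Ω E : Type*} (X : ℕ → Ω → E) (B : Set E) (ω : Ω) : ℕ∞ :=
  {j : ℕ | X j ω ∈ B}.encard

/-- The Poisson distribution with mean `m ∈ [0, ∞]`; for `m = ∞` it is the point mass at `∞`. -/
def poissonLaw (m : ℝ≥0∞) : Measure ℕ∞ :=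
  if m = ∞ then Measure.dirac ⊤ else (poissonMeasure m.toNNReal).map (fun n : ℕ => (n : ℕ∞))

/-- `X 0, X 1, …` is a measurable enumeration of the points of a Poisson point process on `E`
with mean measure `μ`. -/
structure IsPoissonEnumeration {Ω E : Type*} [MeasurableSpace Ω] [MeasurableSpace E]
    (X : ℕ → Ω → E) (μ : Measure E) (P : Measure Ω) : Prop where
  measurable : ∀ j, Measurable (X j)
  hasLaw : ∀ B : Set E, MeasurableSet B → HasLaw (pointCount X B) (poissonLaw (μ B)) P
  indep : ∀ (n : ℕ) (B : Fin n → Set E), (∀ i, MeasurableSet (B i)) →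
    Pairwise (Function.onFun Disjoint B) → iIndepFun (fun i => pointCount X (B i)) P

/-- Lebesgue measure on `ℝ₊`. -/
def lebesguePos : Measure ℝ≥0 := ((volume : Measure ℝ).restrict (Ici 0)).map Real.toNNReal

/-- The measure `α u^{-(1+α)} du ⊗ (1-β) v^{-β} dv ⊗ ν` on `ℝ₊ × ℝ₊ × F(ℝ₊)`. -/
def meanMeasure (α β : ℝ) (ν : Measure ClosedSubset) : Measure (ℝ≥0 × ℝ≥0 × ClosedSubset) :=
  (lebesguePos.withDensity
      fun u => ENNReal.ofReal (α * (u : ℝ) ^ (-(1 + α)))).prod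
    ((lebesguePos.withDensity
      fun v => ENNReal.ofReal ((1 - β) * (v : ℝ) ^ (-β))).prod ν)

/-- The shifted set `v + F`. -/
def shiftedSet (v : ℝ≥0) (F : ClosedSubset) : Set ℝ≥0 := (fun r => v + r) '' F.carrier

/-- The function `η(t) = ∑_j U_j 1{t ∈ V_j + R_j}` attached to points `(U_j, V_j, R_j)`. -/
def etaFun (p : ℕ → ℝ≥0 × ℝ≥0 × ClosedSubset) (t : ℝ≥0) : ℝ≥0∞ :=
  ∑' j, (shiftedSet (p j).2.1 (p j).2.2).indicator (fun _ => ((p j).1 : ℝ≥0∞)) t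

/-- The corresponding sup-measure `η(G) = sup_{t ∈ G} η(t)`. -/
def etaSup (p : ℕ → ℝ≥0 × ℝ≥0 × ClosedSubset) (G : Set ℝ≥0) : ℝ≥0∞ :=
  ⨆ t ∈ G, etaFun p t

end

/-! A large value of `η` on `(0,1)` comes from a single large mark. Only points with `V < 1` matter
there, and `(1-β) v^{-β} dv` has mass one on `(0,1)`, so the number of such points with `U > x` is
Poisson with mean `x^{-α}`. Since `0 ∈ R` almost surely, a point with `0 < V < 1` contributes its
mark at `t = V`; this gives the lower bound `1 - exp(-x^{-α})` (`le_measureReal_lt_etaSup`).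

For the upper bound the other terms of the sum must be controlled. If `m(1-β) > 1`, then almost
surely every `t ∈ (0,1)` lies in fewer than `m` shifted sets with positive mark
(`ae_card_overlap_lt`). So exceeding `y₁ + m y₂` requires one mark above `y₁` or two above `y₂`,
which costs at most `y₁^{-α} + y₂^{-2α}` (`measure_lt_etaSup_le`). With `y₁ ~ x` and `y₂` of order
`x^{3/4}` the second term is `o(x^{-α})`.

The overlap bound rests on `exists_measure_hit_le`: under `(1-β) v^{-β} dv ⊗ ν`, the shifted sets
hitting an interval of length `h` have measure `O(h^{1-β})`. Among `N` intervals of length of order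
`1/N`, the chance that one is hit by `m` sets with marks above `ε` is then `O(N^{1-m(1-β)})`, which
tends to `0`. The hitting bound compares two occupation times. After entering the interval, the
subordinator stays within a further distance `h` for an expected time at least `κ h^β`; but started
from the shift measure, its total occupation measure is a multiple of Lebesgue measure, hence `O(h)`
on the doubled interval. -/

/-! ### Poisson tail probabilities. -/

lemma poissonMeasure_Ici_le (r : ℝ≥0) (n : ℕ) : poissonMeasure r (Ici n) ≤ (r : ℝ≥0∞) ^ n := by
  have hI : Ici n = ⋃ k : ℕ, {n + k} := by
    ext m
    simp only [mem_Ici, mem_iUnion, mem_singleton_iff]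
    exact le_iff_exists_add
  calc poissonMeasure r (Ici n) ≤ ∑' k : ℕ, poissonMeasure r {n + k} := by
        rw [hI]; exact measure_iUnion_le _
    -- As `(n+k)! ≥ k!`, each shifted weight is at most `r^n` times the unshifted one, and the
    -- latter sum to one.
    _ ≤ ∑' k : ℕ, (r : ℝ≥0∞) ^ n * poissonMeasure r {k} := by
        refine ENNReal.tsum_le_tsum fun k => ?_
        rw [poissonMeasure_singleton, poissonMeasure_singleton, ← ENNReal.ofReal_coe_nnreal,
          ← ENNReal.ofReal_pow r.coe_nonneg, ← ENNReal.ofReal_mul (by positivity)]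
        refine ENNReal.ofReal_le_ofReal ?_
        rw [mul_div_assoc', pow_add]
        have : ((k.factorial : ℕ) : ℝ) ≤ ((n + k).factorial : ℕ) := by
          exact_mod_cast Nat.factorial_le (Nat.le_add_left k n)
        calc _ = ((r : ℝ) ^ n * (Real.exp (-r) * r ^ k)) / ((n + k).factorial : ℕ) := by ring
          _ ≤ _ := by gcongr
    _ = (r : ℝ≥0∞) ^ n := by
        rw [ENNReal.tsum_mul_left]
        have : ∑' k : ℕ, poissonMeasure r {k} = 1 := by
          rw [← measure_iUnion (by simp [Pairwise, Function.onFun]) (fun _ => .of_discrete)]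
          simp [Set.iUnion_of_singleton]
        rw [this, mul_one]

namespace IsPoissonEnumeration

variable {Ω E : Type*} [MeasurableSpace Ω] [MeasurableSpace E] {X : ℕ → Ω → E} {μ : Measure E}
  {P : Measure Ω}

lemma measure_le_pointCount (hX : IsPoissonEnumeration X μ P) {B : Set E}
    (hB : MeasurableSet B) (hμ : μ B ≠ ∞) (n : ℕ) :
    P {ω | n ≤ pointCount X B ω} = poissonMeasure (μ B).toNNReal (Ici n) := by
  rw [(hX.hasLaw B hB).measure_eq (p := fun k => n ≤ k) .of_discrete, poissonLaw, if_neg hμ,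
    Measure.map_apply .of_discrete .of_discrete]
  congr 1
  ext k
  simp

lemma measure_le_pointCount_le (hX : IsPoissonEnumeration X μ P) {B : Set E}
    (hB : MeasurableSet B) (hμ : μ B ≠ ∞) (n : ℕ) :
    P {ω | n ≤ pointCount X B ω} ≤ μ B ^ n := by
  rw [hX.measure_le_pointCount hB hμ]
  refine (poissonMeasure_Ici_le _ n).trans_eq ?_
  rw [ENNReal.coe_toNNReal hμ]

lemma measureReal_one_le_pointCount (hX : IsPoissonEnumeration X μ P) {B : Set E}
    (hB : MeasurableSet B) (hμ : μ B ≠ ∞) :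
    P.real {ω | 1 ≤ pointCount X B ω} = 1 - Real.exp (-(μ B).toReal) := by
  have := hX.measure_le_pointCount hB hμ 1
  rw [Nat.cast_one] at this
  rw [measureReal_def, this, ← measureReal_def, show Ici 1 = ({0} : Set ℕ)ᶜ by ext; simp; omega,
    probReal_compl_eq_one_sub .of_discrete, poissonMeasure_real_singleton]
  simp
  rfl

end IsPoissonEnumeration

/-! ### Lebesgue measure on the half-line and the marginals of the mean measure. -/

instance : SFinite lebesguePos := by unfold lebesguePos; infer_instance

lemma lintegral_lebesguePos {f : ℝ≥0 → ℝ≥0∞} (hf : Measurable f) :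
    ∫⁻ x, f x ∂lebesguePos = ∫⁻ x in Ioi (0 : ℝ), f x.toNNReal := by
  rw [lebesguePos, lintegral_map hf measurable_real_toNNReal,
    Measure.restrict_congr_set Ioi_ae_eq_Ici]

lemma lebesguePos_apply {s : Set ℝ≥0} (hs : MeasurableSet s) :
    lebesguePos s = volume ((↑) '' s : Set ℝ) := by
  rw [lebesguePos, Measure.map_apply measurable_real_toNNReal hs,
    Measure.restrict_apply (measurable_real_toNNReal hs)]
  congr 1
  ext x
  simp only [mem_inter_iff, mem_preimage, mem_Ici, mem_image]
  constructor
  · rintro ⟨h, hx⟩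
    exact ⟨_, h, Real.coe_toNNReal x hx⟩
  · rintro ⟨y, hy, rfl⟩
    simpa using hy

lemma lebesguePos_Ioo_le (a h : ℝ≥0) : lebesguePos (Ioo a (a + h)) ≤ h := by
  rw [lebesguePos_apply measurableSet_Ioo]
  calc volume ((↑) '' Ioo a (a + h) : Set ℝ) ≤ volume (Ioo (a : ℝ) (a + h)) := by
        refine measure_mono ?_
        rintro _ ⟨y, ⟨h1, h2⟩, rfl⟩
        exact ⟨by exact_mod_cast h1, by exact_mod_cast h2⟩
    _ = h := by simp

lemma lebesguePos_Iic (a : ℝ≥0) : lebesguePos (Iic a) = a := by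
  rw [lebesguePos_apply measurableSet_Iic,
    show ((↑) '' Iic a : Set ℝ) = Icc (0 : ℝ) a by
      ext x
      constructor
      · rintro ⟨y, hy, rfl⟩
        exact ⟨y.2, by exact_mod_cast hy⟩
      · rintro ⟨h1, h2⟩
        exact ⟨⟨x, h1⟩, h2, rfl⟩]
  simp

/-- Translation `t = s + a`; on `Ici a` the truncated subtraction is genuine. Only this direction of
the equality is needed. -/
lemma lintegral_lebesguePos_add_le {f : ℝ≥0 → ℝ≥0∞} (hf : Measurable f) (a : ℝ≥0) :
    ∫⁻ s, f s ∂lebesguePos ≤ ∫⁻ t in Ici a, f (t - a) ∂lebesguePos := by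
  rw [← lintegral_indicator measurableSet_Ici, lintegral_lebesguePos hf,
    lintegral_lebesguePos (f := (Ici a).indicator fun t => f (t - a))
      ((hf.comp (by fun_prop : Measurable fun t : ℝ≥0 => t - a)).indicator measurableSet_Ici),
    ← lintegral_indicator measurableSet_Ioi, ← lintegral_indicator measurableSet_Ioi]
  rw [← lintegral_sub_right_eq_self (μ := volume) _ (a : ℝ)]
  refine lintegral_mono fun x => ?_
  by_cases hx : (a : ℝ) < x
  · have h0 : 0 < x := a.coe_nonneg.trans_lt hx
    have h1 : a ≤ x.toNNReal := by
      rw [← NNReal.coe_le_coe, Real.coe_toNNReal _ h0.le]; exact hx.le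
    rw [indicator_of_mem (by simpa using hx), indicator_of_mem (by simpa using h0),
      indicator_of_mem (by simpa using h1)]
    refine le_of_eq (congrArg f ?_)
    rw [← NNReal.coe_inj, NNReal.coe_sub h1, Real.coe_toNNReal _ h0.le,
      Real.coe_toNNReal _ (by linarith)]
  · rw [indicator_of_notMem (by simpa using hx)]
    exact zero_le

/-- A real integral over `(0, ∞)` read as an integral over `ℝ₊`. -/
lemma lintegral_lebesguePos_ofReal {f : ℝ → ℝ} (hf : Measurable f)
    (h0 : ∀ x ∈ Ioi (0 : ℝ), 0 ≤ f x) (hi : IntegrableOn f (Ioi 0)) :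
    ∫⁻ x : ℝ≥0, ENNReal.ofReal (f x) ∂lebesguePos = ENNReal.ofReal (∫ x in Ioi 0, f x) := by
  rw [lintegral_lebesguePos (f := fun x : ℝ≥0 => ENNReal.ofReal (f x)) (by fun_prop),
    ofReal_integral_eq_lintegral_ofReal hi
      ((ae_restrict_iff' measurableSet_Ioi).2 (.of_forall h0))]
  refine setLIntegral_congr_fun measurableSet_Ioi fun x hx => ?_
  simp only [Real.coe_toNNReal x (le_of_lt hx)]

lemma lintegral_rpow_mul_exp_lebesguePos {a l : ℝ} (ha : 0 < a) (hl : 0 < l) :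
    ∫⁻ x : ℝ≥0, ENNReal.ofReal ((x : ℝ) ^ (a - 1) * Real.exp (-(l * x))) ∂lebesguePos =
      ENNReal.ofReal ((1 / l) ^ a * Real.Gamma a) := by
  rw [← Real.integral_rpow_mul_exp_neg_mul_Ioi ha hl]
  refine lintegral_lebesguePos_ofReal (f := fun x => x ^ (a - 1) * Real.exp (-(l * x)))
    (by fun_prop) (fun x hx => mul_nonneg (Real.rpow_nonneg (le_of_lt hx) _) (Real.exp_nonneg _)) ?_
  refine Integrable.of_integral_ne_zero ?_
  rw [Real.integral_rpow_mul_exp_neg_mul_Ioi ha hl]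
  have := Real.Gamma_pos_of_pos ha
  positivity

lemma lintegral_exp_lebesguePos {l : ℝ} (hl : 0 < l) :
    ∫⁻ x : ℝ≥0, ENNReal.ofReal (Real.exp (-(l * x))) ∂lebesguePos = ENNReal.ofReal (1 / l) := by
  simpa using lintegral_rpow_mul_exp_lebesguePos one_pos hl

/-- The marginal `α u^{-(1+α)} du` of the mean measure. -/
noncomputable def scaleMeasure (α : ℝ) : Measure ℝ≥0 :=
  lebesguePos.withDensity fun u => ENNReal.ofReal (α * (u : ℝ) ^ (-(1 + α)))

/-- The marginal `(1-β) v^{-β} dv` of the mean measure. -/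
noncomputable def shiftMeasure (β : ℝ) : Measure ℝ≥0 :=
  lebesguePos.withDensity fun v => ENNReal.ofReal ((1 - β) * (v : ℝ) ^ (-β))

instance (α : ℝ) : SFinite (scaleMeasure α) := by unfold scaleMeasure; infer_instance

instance (β : ℝ) : SFinite (shiftMeasure β) := by unfold shiftMeasure; infer_instance

lemma meanMeasure_eq (α β : ℝ) (ν : Measure ClosedSubset) :
    meanMeasure α β ν = (scaleMeasure α).prod ((shiftMeasure β).prod ν) := rfl

lemma scaleMeasure_Ioi {α : ℝ} (hα : 0 < α) {x : ℝ≥0} (hx : 0 < x) :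
    scaleMeasure α (Ioi x) = ENNReal.ofReal ((x : ℝ) ^ (-α)) := by
  have hx' : (0 : ℝ) < x := hx
  rw [scaleMeasure, withDensity_apply _ measurableSet_Ioi, ← lintegral_indicator measurableSet_Ioi]
  have h1 : ((Ioi x).indicator fun u : ℝ≥0 => ENNReal.ofReal (α * (u : ℝ) ^ (-(1 + α)))) =
      fun u : ℝ≥0 => ENNReal.ofReal
        ((Ioi (x : ℝ)).indicator (fun u => α * u ^ (-(1 + α))) (u : ℝ)) := by
    ext u
    by_cases hu : x < u
    · rw [indicator_of_mem (by simpa using hu), indicator_of_mem (by simpa using hu)]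
    · rw [indicator_of_notMem (by simpa using hu), indicator_of_notMem (by simpa using hu)]
      simp
  have hsub : Ioi (x : ℝ) ∩ Ioi 0 = Ioi (x : ℝ) :=
    inter_eq_left.2 (Ioi_subset_Ioi x.2)
  have hint : IntegrableOn (fun u : ℝ => α * u ^ (-(1 + α))) (Ioi (x : ℝ)) :=
    (integrableOn_Ioi_rpow_of_lt (by linarith) hx').const_mul α
  rw [h1, lintegral_lebesguePos_ofReal
    (Measurable.indicator (by fun_prop) measurableSet_Ioi)]
  · congr 1
    rw [setIntegral_indicator measurableSet_Ioi, inter_comm, hsub, integral_const_mul,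
      integral_Ioi_rpow_of_lt (by linarith) hx']
    rw [show -(1 + α) + 1 = -α by ring]
    field_simp
  · intro u hu
    exact indicator_nonneg (fun v hv => mul_nonneg hα.le
      (Real.rpow_nonneg (hx'.le.trans (le_of_lt hv)) _)) u
  · rw [IntegrableOn, integrable_indicator_iff measurableSet_Ioi, IntegrableOn,
      Measure.restrict_restrict measurableSet_Ioi, hsub]
    exact hint

lemma shiftMeasure_Iio_one {β : ℝ} (hβ : β ∈ Ioo (0 : ℝ) 1) : shiftMeasure β (Iio 1) = 1 := by
  have hβ' : -1 < -β := by linarith [hβ.2]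
  rw [shiftMeasure, withDensity_apply _ measurableSet_Iio, ← lintegral_indicator measurableSet_Iio]
  have h1 : ((Iio 1).indicator fun v : ℝ≥0 => ENNReal.ofReal ((1 - β) * (v : ℝ) ^ (-β))) =
      fun v : ℝ≥0 => ENNReal.ofReal
        ((Iio (1 : ℝ)).indicator (fun v => (1 - β) * v ^ (-β)) (v : ℝ)) := by
    ext u
    by_cases hu : u < 1
    · rw [indicator_of_mem (by simpa using hu), indicator_of_mem (by simpa using hu)]
    · rw [indicator_of_notMem (by simpa using hu), indicator_of_notMem (by simpa using hu)]
      simp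
  have hint : IntegrableOn (fun v : ℝ => (1 - β) * v ^ (-β)) (Ioo 0 1) := by
    have := (intervalIntegral.intervalIntegrable_rpow' (a := 0) (b := 1) hβ').const_mul (1 - β)
    rw [intervalIntegrable_iff_integrableOn_Ioc_of_le zero_le_one] at this
    exact this.mono_set Ioo_subset_Ioc_self
  rw [h1, lintegral_lebesguePos_ofReal
    (Measurable.indicator (by fun_prop) measurableSet_Iio)]
  · rw [setIntegral_indicator measurableSet_Iio, Ioi_inter_Iio, ← integral_Ioc_eq_integral_Ioo,
      ← intervalIntegral.integral_of_le zero_le_one, intervalIntegral.integral_const_mul,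
      integral_rpow (Or.inl hβ')]
    have h2 : -β + 1 ≠ 0 := by linarith
    rw [Real.one_rpow, Real.zero_rpow h2, sub_zero, mul_one_div,
      show 1 - β = -β + 1 by ring, div_self h2, ENNReal.ofReal_one]
  · intro u hu
    rw [indicator_apply]
    split_ifs
    · exact mul_nonneg (by linarith [hβ.2]) (Real.rpow_nonneg (le_of_lt hu) _)
    · exact le_rfl
  · rw [IntegrableOn, integrable_indicator_iff measurableSet_Iio, IntegrableOn,
      Measure.restrict_restrict measurableSet_Iio, Iio_inter_Ioi]
    exact hint

lemma shiftMeasure_singleton_zero (β : ℝ) : shiftMeasure β {0} = 0 := by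
  refine withDensity_absolutelyContinuous _ _ ?_
  rw [lebesguePos_apply (measurableSet_singleton 0)]
  simp

lemma shiftMeasure_Ioo_zero_one {β : ℝ} (hβ : β ∈ Ioo (0 : ℝ) 1) :
    shiftMeasure β (Ioo 0 1) = 1 := by
  rw [← shiftMeasure_Iio_one hβ, show Ioo (0 : ℝ≥0) 1 = Iio 1 \ {0} by
    ext x; simp [pos_iff_ne_zero, and_comm],
    measure_sdiff_null (shiftMeasure_singleton_zero β)]

lemma lintegral_exp_shiftMeasure {β : ℝ} (hβ : β ∈ Ioo (0 : ℝ) 1) {l : ℝ} (hl : 0 < l) :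
    ∫⁻ v : ℝ≥0, ENNReal.ofReal (Real.exp (-(l * v))) ∂shiftMeasure β =
      ENNReal.ofReal ((1 - β) * (l ^ (β - 1) * Real.Gamma (1 - β))) := by
  have h1 : 0 < 1 - β := by linarith [hβ.2]
  rw [shiftMeasure, lintegral_withDensity_eq_lintegral_mul _ (by fun_prop) (by fun_prop)]
  calc _ = ∫⁻ v : ℝ≥0, ENNReal.ofReal (1 - β) * ENNReal.ofReal
        ((v : ℝ) ^ ((1 - β) - 1) * Real.exp (-(l * v))) ∂lebesguePos := by
        refine lintegral_congr fun v => ?_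
        rw [Pi.mul_apply, ← ENNReal.ofReal_mul (by positivity), ← ENNReal.ofReal_mul h1.le,
          mul_assoc, sub_sub_cancel_left]
    _ = _ := by
        rw [lintegral_const_mul _ (by fun_prop), lintegral_rpow_mul_exp_lebesguePos h1 hl,
          ← ENNReal.ofReal_mul h1.le, one_div, Real.inv_rpow hl.le, ← Real.rpow_neg hl.le, neg_sub]

/-! ### Uniqueness for the Laplace transform `K / l`. -/

/-- The integrand decreases in `l`, and `K / l` is unbounded as `l → 0+`. Hence two measures with
this transform have equal transforms at every real `l`, as the comparison of moment generating
functions requires. -/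
lemma lintegral_exp_eq_top {W : Measure ℝ≥0} {K : ℝ} (hK : 0 < K)
    (h : ∀ l : ℝ, 0 < l →
      ∫⁻ z : ℝ≥0, ENNReal.ofReal (Real.exp (-(l * z))) ∂W = ENNReal.ofReal (K / l))
    {l : ℝ} (hl : l ≤ 0) : ∫⁻ z : ℝ≥0, ENNReal.ofReal (Real.exp (-(l * z))) ∂W = ∞ := by
  refine ENNReal.eq_top_of_forall_nnreal_le fun r => ?_
  have hr : (0 : ℝ) < r + 1 := by positivity
  calc (r : ℝ≥0∞) ≤ ENNReal.ofReal (K / (K / (r + 1))) := by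
        rw [div_div_cancel₀ hK.ne', ← ENNReal.ofReal_coe_nnreal]
        exact ENNReal.ofReal_le_ofReal (by linarith)
    _ = _ := (h _ (div_pos hK hr)).symm
    _ ≤ _ := by
        refine lintegral_mono fun z => ENNReal.ofReal_le_ofReal (Real.exp_le_exp.2 ?_)
        have h1 : 0 ≤ K / (r + 1) := (div_pos hK hr).le
        nlinarith [mul_nonneg h1 z.coe_nonneg, mul_nonneg (neg_nonneg.2 hl) z.coe_nonneg]

/-- A measure on `ℝ₊` with Laplace transform `K / l` is `K` times Lebesgue measure. -/
lemma eq_smul_lebesguePos_of_laplace {W : Measure ℝ≥0} {K : ℝ} (hK : 0 < K)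
    (h : ∀ l : ℝ, 0 < l →
      ∫⁻ z : ℝ≥0, ENNReal.ofReal (Real.exp (-(l * z))) ∂W = ENNReal.ofReal (K / l)) :
    W = ENNReal.ofReal K • lebesguePos := by
  set W' := ENNReal.ofReal K • lebesguePos with hW'
  have h' : ∀ l : ℝ, 0 < l →
      ∫⁻ z : ℝ≥0, ENNReal.ofReal (Real.exp (-(l * z))) ∂W' = ENNReal.ofReal (K / l) := by
    intro l hl
    rw [hW', lintegral_smul_measure, lintegral_exp_lebesguePos hl, smul_eq_mul,
      ← ENNReal.ofReal_mul hK.le, mul_one_div]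
  -- Tilting by `exp(-z)` makes the measures finite, with exponential moments for all `t < 1`. Since
  -- `0` is interior to that range, the moment generating function determines the characteristic
  -- function; the tilt is then undone.
  let f : ℝ≥0 → ℝ≥0∞ := fun z => ENNReal.ofReal (Real.exp (-z))
  have hf : Measurable f := by fun_prop
  have hemb : MeasurableEmbedding ((↑) : ℝ≥0 → ℝ) := .subtype_coe measurableSet_Ici
  let T : Measure ℝ≥0 → Measure ℝ := fun V => (V.withDensity f).map (↑)
  have hlint : ∀ V : Measure ℝ≥0, ∀ t : ℝ, ∫⁻ x, ENNReal.ofReal (Real.exp (t * x)) ∂(T V) =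
      ∫⁻ z : ℝ≥0, ENNReal.ofReal (Real.exp (-((1 - t) * z))) ∂V := by
    intro V t
    rw [lintegral_map (by fun_prop) (by fun_prop),
      lintegral_withDensity_eq_lintegral_mul _ hf (by fun_prop)]
    refine lintegral_congr fun z => ?_
    rw [Pi.mul_apply, ← ENNReal.ofReal_mul (Real.exp_nonneg _), ← Real.exp_add]
    ring_nf
  have heq : ∀ l : ℝ, ∫⁻ z : ℝ≥0, ENNReal.ofReal (Real.exp (-(l * z))) ∂W =
      ∫⁻ z : ℝ≥0, ENNReal.ofReal (Real.exp (-(l * z))) ∂W' := by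
    intro l
    rcases lt_or_ge 0 l with hl | hl
    · rw [h l hl, h' l hl]
    · rw [lintegral_exp_eq_top hK h hl, lintegral_exp_eq_top hK h' hl]
  have huniv : ∀ V : Measure ℝ≥0, T V univ =
      ∫⁻ z : ℝ≥0, ENNReal.ofReal (Real.exp (-(1 * z))) ∂V := by
    intro V
    simpa using hlint V 0
  have hmgf : mgf id (T W) = mgf id (T W') := by
    ext t
    rw [mgf, mgf, integral_eq_lintegral_of_nonneg_ae (.of_forall fun _ => Real.exp_nonneg _)
      (by fun_prop), integral_eq_lintegral_of_nonneg_ae (.of_forall fun _ => Real.exp_nonneg _)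
      (by fun_prop)]
    simp only [id, hlint, heq]
  have hz : T W = 0 ↔ T W' = 0 := by
    rw [← Measure.measure_univ_eq_zero, ← Measure.measure_univ_eq_zero, huniv, huniv, heq]
  have hfin : IsFiniteMeasure (T W) := ⟨by rw [huniv, h 1 one_pos]; exact ENNReal.ofReal_lt_top⟩
  have hfin' : IsFiniteMeasure (T W') :=
    ⟨by rw [huniv, h' 1 one_pos]; exact ENNReal.ofReal_lt_top⟩
  have hset : (0 : ℝ) ∈ interior (integrableExpSet id (T W)) := by
    refine mem_interior.2 ⟨Iio 1, fun t ht => ?_, isOpen_Iio, by simp⟩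
    refine ⟨by fun_prop, ?_⟩
    rw [hasFiniteIntegral_iff_ofReal (.of_forall fun _ => Real.exp_nonneg _)]
    simp only [id]
    rw [hlint, h _ (sub_pos.2 ht)]
    exact ENNReal.ofReal_lt_top
  have hT : T W = T W' := by
    refine Measure.ext_of_charFun (funext fun t => ?_)
    rw [← complexMGF_id_mul_I, ← complexMGF_id_mul_I]
    exact eqOn_complexMGF_of_mgf' hmgf hz (by simpa using hset)
  have hT' : W.withDensity f = W'.withDensity f := by
    rw [← hemb.comap_map (W.withDensity f), ← hemb.comap_map (W'.withDensity f)]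
    exact congrArg _ hT
  have hinv : ∀ V : Measure ℝ≥0, (V.withDensity f).withDensity (f⁻¹) = V := fun V =>
    withDensity_inv_same hf (.of_forall fun z => by simp [f, Real.exp_pos])
      (.of_forall fun z => by simp [f])
  rw [← hinv W, hT', hinv]

/-! ### Subordinators: joint measurability and hitting of open sets. -/

/-- Approximation from the right by countable grids, matching right-continuity of the paths; it
yields joint measurability in time and `ω`. -/
lemma tendsto_floor_add_one_div (t : ℝ≥0) :
    Tendsto (fun n : ℕ => ((⌊((n : ℝ≥0) + 1) * t⌋₊ : ℝ≥0) + 1) / ((n : ℝ≥0) + 1)) atTop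
      (𝓝[Ici t] t) := by
  have hlt : ∀ n : ℕ, t ≤ ((⌊((n : ℝ≥0) + 1) * t⌋₊ : ℝ≥0) + 1) / ((n : ℝ≥0) + 1) := fun n => by
    rw [le_div_iff₀ (by positivity), mul_comm]
    exact (Nat.lt_floor_add_one _).le
  have hle : ∀ n : ℕ, ((⌊((n : ℝ≥0) + 1) * t⌋₊ : ℝ≥0) + 1) / ((n : ℝ≥0) + 1) ≤
      t + 1 / ((n : ℝ≥0) + 1) := fun n => by
    have h0 : (0 : ℝ≥0) < (n : ℝ≥0) + 1 := by positivity
    rw [div_le_iff₀ h0, add_mul t, one_div, inv_mul_cancel₀ h0.ne', mul_comm t]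
    gcongr
    exact Nat.floor_le (by positivity)
  refine tendsto_nhdsWithin_iff.2 ⟨?_, .of_forall hlt⟩
  refine tendsto_of_tendsto_of_tendsto_of_le_of_le tendsto_const_nhds ?_ hlt hle
  simpa using tendsto_const_nhds.add (tendsto_one_div_add_atTop_nhds_zero_nat (𝕜 := ℝ≥0))

namespace IsStableSubordinator

variable {Ω : Type*} [MeasurableSpace Ω] {β : ℝ} {σ : ℝ≥0 → Ω → ℝ≥0} {P : Measure Ω}

lemma measurable_comp_comp (hσ : ∀ t, Measurable (σ t)) (φ : ℕ → ℝ≥0)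
    {κ : ℝ≥0 → ℕ} (hκ : Measurable κ) : Measurable fun p : ℝ≥0 × Ω => σ (φ (κ p.1)) p.2 := by
  have h1 : Measurable fun q : ℕ × Ω => σ (φ q.1) q.2 :=
    measurable_from_prod_countable_right fun k => hσ (φ k)
  exact h1.comp (f := fun p : ℝ≥0 × Ω => (κ p.1, p.2)) (by fun_prop)

lemma measurable_uncurry (hσ : IsStableSubordinator β σ P) :
    Measurable (Function.uncurry σ) := by
  have hm : ∀ n : ℕ, Measurable fun p : ℝ≥0 × Ω =>
      σ (((⌊((n : ℝ≥0) + 1) * p.1⌋₊ : ℝ≥0) + 1) / ((n : ℝ≥0) + 1)) p.2 := fun n => by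
    have hκ : Measurable fun t : ℝ≥0 => ⌊((n : ℝ≥0) + 1) * t⌋₊ :=
      (measurable_const_mul ((n : ℝ≥0) + 1)).nat_floor
    have := measurable_comp_comp hσ.measurable (fun k => ((k : ℝ≥0) + 1) / ((n : ℝ≥0) + 1)) hκ
    exact this
  exact measurable_of_tendsto_metrizable hm (tendsto_pi_nhds.2 fun p =>
    (hσ.rightContinuous p.2 p.1).tendsto.comp (tendsto_floor_add_one_div p.1))

/-- The past of the skeleton at step `k` is independent of the next increment. -/
lemma measure_inter_increment (hσ : IsStableSubordinator β σ P) (δ s h : ℝ≥0) (k : ℕ)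
    {S : Set (ℕ → ℝ≥0)} (hS : MeasurableSet S) :
    P ({ω | (fun j => σ ((min j k : ℕ) * δ) ω) ∈ S} ∩ {ω | σ (k * δ + s) ω - σ (k * δ) ω ≤ h}) =
      P {ω | (fun j => σ ((min j k : ℕ) * δ) ω) ∈ S} * P {ω | σ s ω ≤ h} := by
  -- The times `0, δ, …, kδ, kδ + s`, constant afterwards: increments with index below `k` encode
  -- the past, and increment `k` is the next one.
  let τ : ℕ → ℝ≥0 := fun i => if i ≤ k then i * δ else k * δ + s
  have hτ : Monotone τ := by
    intro i j hij
    simp only [τ]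
    split_ifs with h1 h2
    · gcongr
    · exact le_add_right (by gcongr)
    · omega
    · exact le_rfl
  have hind := hσ.indepIncrements.nat hτ
  have hmeas : ∀ i, Measurable fun ω => σ (τ (i + 1)) ω - σ (τ i) ω :=
    fun i => (hσ.measurable _).sub (hσ.measurable _)
  have hI := hind.indepFun_finset (Finset.range k) {k} (by simp) hmeas
  let past : (Finset.range k → ℝ≥0) → ℕ → ℝ≥0 := fun y j =>
    ∑ i : Finset.range k, if (i : ℕ) < j then y i else 0
  have hpast_meas : Measurable past := by
    refine measurable_pi_lambda _ fun j => Finset.measurable_sum _ fun i _ => ?_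
    split_ifs <;> fun_prop
  let next : (({k} : Finset ℕ) → ℝ≥0) → ℝ≥0 := fun y => y ⟨k, by simp⟩
  have hnext_meas : Measurable next := by fun_prop
  have htel : ∀ j, j ≤ k → ∀ ω,
      ∑ i ∈ Finset.range j, (σ (τ (i + 1)) ω - σ (τ i) ω) = σ (j * δ) ω := by
    intro j hj ω
    rw [Finset.sum_range_tsub (f := fun i => σ (τ i) ω) fun a b hab => hσ.monotone ω (hτ hab)]
    simp [τ, hj, hσ.zero]
  have hpast : ∀ ω, past (fun i => σ (τ (i + 1)) ω - σ (τ i) ω) =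
      fun j => σ ((min j k : ℕ) * δ) ω := by
    intro ω
    ext1 j
    simp only [past]
    rw [Finset.sum_coe_sort (Finset.range k)
      (fun i => if i < j then σ (τ (i + 1)) ω - σ (τ i) ω else 0), ← Finset.sum_filter,
      show (Finset.range k).filter (· < j) = Finset.range (min j k) by ext; simp; omega,
      htel _ (min_le_right _ _)]
  have hnext : ∀ ω, next (fun i => σ (τ (i + 1)) ω - σ (τ i) ω) =
      σ (k * δ + s) ω - σ (k * δ) ω := by
    intro ω
    simp [next, τ]
  have hJ := (hI.comp hpast_meas hnext_meas).measure_inter_preimage_eq_mul S (Iic h) hS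
    measurableSet_Iic
  have hst := (hσ.stationaryIncrements (k * δ) s).measure_mem_eq (measurableSet_Iic (a := h))
  have e1 : (past ∘ fun ω (i : Finset.range k) => σ (τ (i + 1)) ω - σ (τ i) ω) ⁻¹' S =
      {ω | (fun j => σ ((min j k : ℕ) * δ) ω) ∈ S} := by
    ext ω
    simp only [mem_preimage, Function.comp_apply, hpast, mem_ofPred_eq]
  have e2 : (next ∘ fun ω (i : ({k} : Finset ℕ)) => σ (τ (i + 1)) ω - σ (τ i) ω) ⁻¹' Iic h =
      {ω | σ (k * δ + s) ω - σ (k * δ) ω ≤ h} := by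
    ext ω
    simp only [mem_preimage, Function.comp_apply, hnext, mem_ofPred_eq, mem_Iic]
  rw [e1, e2] at hJ
  rw [hJ]
  congr 1

lemma antitone_measure_le (hσ : IsStableSubordinator β σ P) (h : ℝ≥0) :
    Antitone fun s => P {ω | σ s ω ≤ h} :=
  fun _ _ hst => measure_mono fun ω hω => (hσ.monotone ω hst).trans hω

/-- Hitting a set `H` by a skeleton of the subordinator, compared with occupation of `H'`. -/
lemma measure_skeleton_hit_mul_le (hσ : IsStableSubordinator β σ P) {H H' : Set ℝ≥0} {h : ℝ≥0}
    (hH : MeasurableSet H) (hHH' : ∀ r ∈ H, ∀ s ≤ h, r + s ∈ H') (δ : ℝ≥0) :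
    P {ω | ∃ k : ℕ, σ (k * δ) ω ∈ H} * ∫⁻ s, P {ω | σ s ω ≤ h} ∂lebesguePos ≤
      ∫⁻ t, P {ω | σ t ω ∈ H'} ∂lebesguePos := by
  -- A strong Markov argument at the first skeleton time in `H`. Freezing the skeleton at step `k`
  -- makes the event `D k` of first entry at step `k` depend on the past alone.
  let S : ℕ → Set (ℕ → ℝ≥0) := fun k => {y | y k ∈ H ∧ ∀ j < k, y j ∉ H}
  have hS : ∀ k, MeasurableSet (S k) := fun k => by
    have : S k = (fun y => y k) ⁻¹' H ∩ ⋂ j, ⋂ (_ : j < k), ((fun y => y j) ⁻¹' H)ᶜ := by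
      ext y; simp [S]
    rw [this]
    exact (measurable_pi_apply k hH).inter
      (.iInter fun j => .iInter fun _ => (measurable_pi_apply j hH).compl)
  let D : ℕ → Set Ω := fun k => {ω | (fun j => σ ((min j k : ℕ) * δ) ω) ∈ S k}
  have hD : ∀ k ω, ω ∈ D k ↔ σ (k * δ) ω ∈ H ∧ ∀ j < k, σ (j * δ) ω ∉ H := by
    intro k ω
    simp only [D, S, mem_ofPred_eq, min_self]
    refine and_congr_right fun _ => forall₂_congr fun j hj => ?_
    rw [min_eq_left hj.le]
  have hDm : ∀ k, MeasurableSet (D k) := fun k =>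
    (measurable_pi_lambda _ fun j => hσ.measurable _) (hS k)
  have hdisj : Pairwise (Function.onFun Disjoint D) := by
    intro i j hij
    refine Set.disjoint_left.2 fun ω hi hj => ?_
    rcases lt_or_gt_of_ne hij with h | h
    · exact ((hD j ω).1 hj).2 i h ((hD i ω).1 hi).1
    · exact ((hD i ω).1 hi).2 j h ((hD j ω).1 hj).1
  have hA : {ω | ∃ k : ℕ, σ (k * δ) ω ∈ H} ⊆ ⋃ k, D k := by
    classical
    intro ω hω
    refine mem_iUnion.2 ⟨Nat.find hω, (hD _ ω).2 ⟨Nat.find_spec hω, fun j hj => Nat.find_min hω hj⟩⟩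
  have hanti := (hσ.antitone_measure_le h).measurable
  calc P {ω | ∃ k : ℕ, σ (k * δ) ω ∈ H} * ∫⁻ s, P {ω | σ s ω ≤ h} ∂lebesguePos
      ≤ (∑' k, P (D k)) * ∫⁻ s, P {ω | σ s ω ≤ h} ∂lebesguePos := by
        gcongr
        exact (measure_mono hA).trans (measure_iUnion_le _)
    _ = ∑' k, ∫⁻ s, P (D k) * P {ω | σ s ω ≤ h} ∂lebesguePos := by
        rw [← ENNReal.tsum_mul_right]
        refine tsum_congr fun k => ?_
        rw [lintegral_const_mul _ hanti]
    _ ≤ ∑' k : ℕ, ∫⁻ t, (Ici (k * δ)).indicator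
          (fun t => P (D k) * P {ω | σ (t - k * δ) ω ≤ h}) t ∂lebesguePos := by
        refine ENNReal.tsum_le_tsum fun k => ?_
        rw [lintegral_indicator measurableSet_Ici]
        exact lintegral_lebesguePos_add_le (f := fun s => P (D k) * P {ω | σ s ω ≤ h})
          (hanti.const_mul _) (k * δ)
    _ = ∫⁻ t, ∑' k : ℕ, (Ici (k * δ)).indicator
          (fun t => P (D k) * P {ω | σ (t - k * δ) ω ≤ h}) t ∂lebesguePos := by
        refine (lintegral_tsum fun k => ?_).symm
        refine (Measurable.indicator ?_ measurableSet_Ici).aemeasurable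
        exact (hanti.comp (by fun_prop : Measurable fun t : ℝ≥0 => t - k * δ)).const_mul _
    -- For fixed `t`, independence turns each summand into the probability of first entry at step
    -- `k` followed by an increment of at most `h`. These events are disjoint in `k` and each forces
    -- `σ t ∈ H'`.
    _ ≤ ∫⁻ t, P {ω | σ t ω ∈ H'} ∂lebesguePos := by
        refine lintegral_mono fun t => ?_
        let E : ℕ → Set Ω := fun k => {ω | k * δ ≤ t ∧ σ t ω - σ (k * δ) ω ≤ h}
        have hEm : ∀ k, MeasurableSet (E k) := fun k =>
          (MeasurableSet.const _).inter
            (((hσ.measurable t).sub (hσ.measurable (k * δ))) measurableSet_Iic)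
        calc _ = ∑' k, P (D k ∩ E k) := by
              refine tsum_congr fun k => ?_
              by_cases hk : k * δ ≤ t
              · rw [indicator_of_mem (by exact hk)]
                have := hσ.measure_inter_increment δ (t - k * δ) h k (hS k)
                rw [add_tsub_cancel_of_le hk] at this
                rw [← this]
                congr 1
                ext ω
                simp [D, E, hk]
              · rw [indicator_of_notMem (by exact hk)]
                simp [E, hk]
          _ = P (⋃ k, D k ∩ E k) := by
              refine (measure_iUnion ?_ fun k => (hDm k).inter (hEm k)).symm
              exact fun i j hij => (hdisj hij).mono inter_subset_left inter_subset_left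
          _ ≤ _ := by
              refine measure_mono (iUnion_subset fun k ω hω => ?_)
              have h1 := hHH' _ ((hD k ω).1 hω.1).1 _ hω.2.2
              rwa [add_tsub_cancel_of_le (hσ.monotone ω hω.2.1)] at h1

/-- By right-continuity a visit to the open set `H` lasts for a positive time, so a fine enough
dyadic skeleton sees it. Dyadic skeletons are nested, and continuity from below passes to the limit.
-/
lemma measure_range_hit_mul_le (hσ : IsStableSubordinator β σ P) {H H' : Set ℝ≥0} {h : ℝ≥0}
    (hH : IsOpen H) (hHH' : ∀ r ∈ H, ∀ s ≤ h, r + s ∈ H') :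
    P {ω | ∃ t, σ t ω ∈ H} * ∫⁻ s, P {ω | σ s ω ≤ h} ∂lebesguePos ≤
      ∫⁻ t, P {ω | σ t ω ∈ H'} ∂lebesguePos := by
  let A : ℕ → Set Ω := fun n => {ω | ∃ k : ℕ, σ (k * (2⁻¹ ^ n : ℝ≥0)) ω ∈ H}
  have hmono : Monotone A := by
    refine monotone_nat_of_le_succ fun n ω => ?_
    rintro ⟨k, hk⟩
    refine ⟨2 * k, ?_⟩
    convert hk using 2
    push_cast
    rw [pow_succ]
    field_simp
  have hsub : {ω | ∃ t, σ t ω ∈ H} ⊆ ⋃ n, A n := by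
    rintro ω ⟨t, ht⟩
    have h1 : ∀ᶠ s in 𝓝[≥] t, σ s ω ∈ H := (hσ.rightContinuous ω t).tendsto (hH.mem_nhds ht)
    obtain ⟨u, htu, hu⟩ := (mem_nhdsGE_iff_exists_Ico_subset).1 h1
    obtain ⟨n, hn⟩ := NNReal.exists_pow_lt_of_lt_one (tsub_pos_of_lt htu)
      (by norm_num : (2⁻¹ : ℝ≥0) < 1)
    refine mem_iUnion.2 ⟨n, ⌈t / 2⁻¹ ^ n⌉₊, hu ⟨?_, ?_⟩⟩
    · rw [← div_le_iff₀ (by positivity)]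
      exact Nat.le_ceil _
    · have h2 : (⌈t / 2⁻¹ ^ n⌉₊ : ℝ≥0) < t / 2⁻¹ ^ n + 1 := Nat.ceil_lt_add_one (by positivity)
      calc (⌈t / 2⁻¹ ^ n⌉₊ : ℝ≥0) * 2⁻¹ ^ n < (t / 2⁻¹ ^ n + 1) * 2⁻¹ ^ n := by gcongr
        _ = t + 2⁻¹ ^ n := by field_simp
        _ < t + (u - t) := by gcongr
        _ = u := add_tsub_cancel_of_le htu.le
  calc _ ≤ P (⋃ n, A n) * ∫⁻ s, P {ω | σ s ω ≤ h} ∂lebesguePos := by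
        gcongr
    _ = ⨆ n, P (A n) * ∫⁻ s, P {ω | σ s ω ≤ h} ∂lebesguePos := by
        rw [hmono.measure_iUnion, ENNReal.iSup_mul]
    _ ≤ _ := iSup_le fun n => hσ.measure_skeleton_hit_mul_le hH.measurableSet hHH' _

end IsStableSubordinator

/-! ### Measurability of hitting events for the Fell topology. -/

namespace ClosedSubset

lemma measurableSet_hit {G : Set ℝ≥0} (hG : IsOpen G) :
    MeasurableSet {F : ClosedSubset | (F.carrier ∩ G).Nonempty} :=
  (TopologicalSpace.isOpen_generateFrom_of_mem (Or.inl ⟨G, hG, rfl⟩)).measurableSet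

lemma measurableSet_zero_mem : MeasurableSet {F : ClosedSubset | 0 ∈ F.carrier} := by
  have h : IsOpen {F : ClosedSubset | F.carrier ∩ {0} = ∅} :=
    TopologicalSpace.isOpen_generateFrom_of_mem (Or.inr ⟨{0}, isCompact_singleton, rfl⟩)
  have := h.measurableSet.compl
  convert this using 1
  ext F
  simp

end ClosedSubset

lemma shiftedSet_inter_nonempty_iff (v : ℝ≥0) (F : ClosedSubset) (G : Set ℝ≥0) :
    (shiftedSet v F ∩ G).Nonempty ↔ (F.carrier ∩ {r | v + r ∈ G}).Nonempty := by
  constructor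
  · rintro ⟨_, ⟨r, hr, rfl⟩, hG⟩
    exact ⟨r, hr, hG⟩
  · rintro ⟨r, hr, hG⟩
    exact ⟨_, ⟨r, hr, rfl⟩, hG⟩

/-- Continuity of addition makes `{(v, r) | v + r ∈ G}` open, hence a countable union of basic
rectangles; each contributes a product of an open set and a Fell-open set. -/
lemma measurableSet_shiftedSet_hit {G : Set ℝ≥0} (hG : IsOpen G) :
    MeasurableSet {p : ℝ≥0 × ClosedSubset | (shiftedSet p.1 p.2 ∩ G).Nonempty} := by
  let b := TopologicalSpace.countableBasis ℝ≥0
  have hb : TopologicalSpace.IsTopologicalBasis b := TopologicalSpace.isBasis_countableBasis ℝ≥0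
  have hO : IsOpen {q : ℝ≥0 × ℝ≥0 | q.1 + q.2 ∈ G} := hG.preimage (by fun_prop)
  have heq : {p : ℝ≥0 × ClosedSubset | (shiftedSet p.1 p.2 ∩ G).Nonempty} =
      ⋃ A ∈ b, ⋃ B ∈ b, ⋃ _ : A ×ˢ B ⊆ {q : ℝ≥0 × ℝ≥0 | q.1 + q.2 ∈ G},
        A ×ˢ {F : ClosedSubset | (F.carrier ∩ B).Nonempty} := by
    ext ⟨v, F⟩
    simp only [mem_ofPred_eq, shiftedSet_inter_nonempty_iff, mem_iUnion, mem_prod, exists_prop]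
    constructor
    · rintro ⟨r, hr, hG⟩
      obtain ⟨_, ⟨A, hA, B, hB, rfl⟩, hAB, hsub⟩ :=
        (hb.prod hb).exists_subset_of_mem_open (a := (v, r)) hG hO
      exact ⟨A, hA, B, hB, hsub, hAB.1, r, hr, hAB.2⟩
    · rintro ⟨A, hA, B, hB, hsub, hv, r, hr, hrB⟩
      exact ⟨r, hr, hsub (show (v, r) ∈ A ×ˢ B from ⟨hv, hrB⟩)⟩
  have hc : b.Countable := TopologicalSpace.countable_countableBasis ℝ≥0
  rw [heq]
  exact .biUnion hc fun A hA => .biUnion hc fun B hB => .iUnion fun _ =>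
    (hb.isOpen hA).measurableSet.prod (ClosedSubset.measurableSet_hit (hb.isOpen hB))

/-! ### Occupation estimates and the hitting bound. -/

namespace IsStableSubordinator

variable {Ω : Type*} [MeasurableSpace Ω] {β : ℝ} {σ : ℝ≥0 → Ω → ℝ≥0} {P : Measure Ω}

lemma exists_lintegral_exp [IsProbabilityMeasure P] (hσ : IsStableSubordinator β σ P) :
    ∃ c : ℝ, 0 < c ∧ ∀ (t : ℝ≥0) (l : ℝ), 0 < l →
      ∫⁻ ω, ENNReal.ofReal (Real.exp (-(l * σ t ω))) ∂P =
        ENNReal.ofReal (Real.exp (-(c * l ^ β * t))) := by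
  obtain ⟨c, hc, h⟩ := hσ.laplace
  refine ⟨c, hc, fun t l hl => ?_⟩
  have hm := hσ.measurable t
  have h1 := h t l.toNNReal
  simp only [Real.coe_toNNReal l hl.le] at h1
  rw [mul_right_comm, ← h1, ofReal_integral_eq_lintegral_ofReal]
  · refine Integrable.of_bound (C := 1) (by fun_prop) (.of_forall fun ω => ?_)
    rw [Real.norm_of_nonneg (Real.exp_nonneg _), Real.exp_le_one_iff, neg_nonpos]
    positivity
  · exact .of_forall fun _ => Real.exp_nonneg _

/-- For `s ≤ h^β / (4c)` the Laplace transform at `1/h` is at least `3/4`, while the event `σ s > h`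
contributes at most `exp(-1) ≤ 1/2`. So `σ s ≤ h` has probability at least `1/4` for all such `s`,
giving `κ = 1/(16c)`. -/
lemma exists_le_lintegral_measure_le [IsProbabilityMeasure P] (hσ : IsStableSubordinator β σ P) :
    ∃ κ : ℝ, 0 < κ ∧ ∀ h : ℝ≥0, 0 < h →
      ENNReal.ofReal (κ * (h : ℝ) ^ β) ≤ ∫⁻ s, P {ω | σ s ω ≤ h} ∂lebesguePos := by
  obtain ⟨c, hc, hL⟩ := hσ.exists_lintegral_exp
  refine ⟨1 / (16 * c), by positivity, fun h hh => ?_⟩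
  have hh' : (0 : ℝ) < h := hh
  have hpow : 0 < (h : ℝ) ^ β := Real.rpow_pos_of_pos hh' β
  let s₀ : ℝ≥0 := ((h : ℝ) ^ β / (4 * c)).toNNReal
  have hs₀ : (s₀ : ℝ) = (h : ℝ) ^ β / (4 * c) := Real.coe_toNNReal _ (by positivity)
  have key : ∀ s ≤ s₀, ENNReal.ofReal (1 / 4) ≤ P {ω | σ s ω ≤ h} := by
    intro s hs
    have hs' : (s : ℝ) ≤ (h : ℝ) ^ β / (4 * c) := by
      rw [← hs₀]; exact_mod_cast hs
    have hlow : (3 / 4 : ℝ) ≤ Real.exp (-(c * (1 / (h : ℝ)) ^ β * s)) := by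
      have h1 : c * (1 / (h : ℝ)) ^ β * s ≤ 1 / 4 := by
        rw [one_div, Real.inv_rpow hh'.le]
        calc c * ((h : ℝ) ^ β)⁻¹ * s ≤ c * ((h : ℝ) ^ β)⁻¹ * ((h : ℝ) ^ β / (4 * c)) := by gcongr
          _ = 1 / 4 := by field_simp
      linarith [Real.add_one_le_exp (-(c * (1 / (h : ℝ)) ^ β * s))]
    have hexp : Real.exp (-1) ≤ 1 / 2 := by
      have := Real.exp_neg_one_lt_d9
      norm_num at this ⊢
      linarith
    have hup : ENNReal.ofReal (3 / 4) ≤ P {ω | σ s ω ≤ h} + ENNReal.ofReal (1 / 2) := by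
      calc ENNReal.ofReal (3 / 4) ≤ _ := ENNReal.ofReal_le_ofReal hlow
        _ = _ := (hL s (1 / h) (by positivity)).symm
        _ ≤ ∫⁻ ω, ({ω | σ s ω ≤ h}.indicator 1 ω + ENNReal.ofReal (1 / 2)) ∂P := by
            refine lintegral_mono fun ω => ?_
            by_cases hω : σ s ω ≤ h
            · rw [indicator_of_mem (by exact hω)]
              refine le_add_right ?_
              rw [Pi.one_apply, ENNReal.ofReal_le_one, Real.exp_le_one_iff, neg_nonpos]
              positivity
            · rw [indicator_of_notMem (by exact hω), zero_add]
              refine ENNReal.ofReal_le_ofReal (le_trans (Real.exp_le_exp.2 ?_) hexp)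
              rw [neg_le_neg_iff, one_div, ← div_eq_inv_mul, one_le_div hh']
              exact_mod_cast (not_le.1 hω).le
        _ = _ := by
            have hm : MeasurableSet {ω | σ s ω ≤ h} := hσ.measurable s measurableSet_Iic
            rw [lintegral_add_right _ measurable_const, lintegral_indicator_one hm]
            simp
    have h3 : ENNReal.ofReal (3 / 4) = ENNReal.ofReal (1 / 4) + ENNReal.ofReal (1 / 2) := by
      rw [← ENNReal.ofReal_add (by norm_num) (by norm_num)]; norm_num
    rw [h3] at hup
    exact (ENNReal.add_le_add_iff_right ENNReal.ofReal_ne_top).1 hup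
  calc ENNReal.ofReal (1 / (16 * c) * (h : ℝ) ^ β)
      = ENNReal.ofReal (1 / 4) * lebesguePos (Iic s₀) := by
        rw [lebesguePos_Iic, ← ENNReal.ofReal_coe_nnreal, ← ENNReal.ofReal_mul (by norm_num)]
        congr 1
        rw [hs₀]
        field_simp
        norm_num
    _ = ∫⁻ _ in Iic s₀, ENNReal.ofReal (1 / 4) ∂lebesguePos := by rw [setLIntegral_const]
    _ ≤ ∫⁻ s in Iic s₀, P {ω | σ s ω ≤ h} ∂lebesguePos := setLIntegral_mono' measurableSet_Iic key
    _ ≤ _ := setLIntegral_le_lintegral _ _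

/-- Started from the stationary shift, the subordinator occupies intervals uniformly. -/
lemma exists_occupation_le [IsProbabilityMeasure P] (hσ : IsStableSubordinator β σ P)
    (hβ : β ∈ Ioo (0 : ℝ) 1) :
    ∃ K : ℝ, 0 < K ∧ ∀ a h : ℝ≥0,
      ∫⁻ v, ∫⁻ t, P {ω | v + σ t ω ∈ Ioo a (a + h)} ∂lebesguePos ∂shiftMeasure β ≤
        ENNReal.ofReal (K * h) := by
  obtain ⟨c, hc, hL⟩ := hσ.exists_lintegral_exp
  have h1 : 0 < 1 - β := by linarith [hβ.2]
  have hG := Real.Gamma_pos_of_pos h1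
  let K : ℝ := (1 - β) * Real.Gamma (1 - β) / c
  have hK : 0 < K := by positivity
  have hum := hσ.measurable_uncurry
  have hm : Measurable fun p : ℝ≥0 × ℝ≥0 × Ω => p.1 + σ p.2.1 p.2.2 :=
    measurable_fst.add (hum.comp measurable_snd)
  -- The shift measure convolved with the potential measure of `σ`. Their transforms are
  -- proportional to `l^{β-1}` and `l^{-β}`, so the product is `K / l`.
  let W : Measure ℝ≥0 := ((shiftMeasure β).prod (lebesguePos.prod P)).map
    fun p => p.1 + σ p.2.1 p.2.2
  have hW : W = ENNReal.ofReal K • lebesguePos := by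
    refine eq_smul_lebesguePos_of_laplace hK fun l hl => ?_
    have hlβ : 0 < l ^ β := Real.rpow_pos_of_pos hl β
    have hm1 : Measurable fun q : ℝ≥0 × Ω => ENNReal.ofReal (Real.exp (-(l * σ q.1 q.2))) := by
      have : Measurable fun q : ℝ≥0 × Ω => σ q.1 q.2 := hum
      fun_prop
    have hin : ∫⁻ q : ℝ≥0 × Ω, ENNReal.ofReal (Real.exp (-(l * σ q.1 q.2)))
        ∂(lebesguePos.prod P) = ENNReal.ofReal (1 / (c * l ^ β)) := by
      rw [lintegral_prod _ hm1.aemeasurable]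
      simp only [hL _ l hl]
      exact lintegral_exp_lebesguePos (by positivity)
    rw [lintegral_map (by fun_prop) hm, lintegral_prod _ (by fun_prop)]
    calc _ = ∫⁻ v : ℝ≥0, ENNReal.ofReal (Real.exp (-(l * v))) * ENNReal.ofReal (1 / (c * l ^ β))
          ∂shiftMeasure β := by
          refine lintegral_congr fun v => ?_
          rw [← hin, ← lintegral_const_mul _ hm1]
          refine lintegral_congr fun q => ?_
          rw [← ENNReal.ofReal_mul (Real.exp_nonneg _), ← Real.exp_add]
          push_cast
          ring_nf
      _ = _ := by
          rw [lintegral_mul_const _ (by fun_prop), lintegral_exp_shiftMeasure hβ hl,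
            ← ENNReal.ofReal_mul (by positivity), Real.rpow_sub hl, Real.rpow_one]
          congr 1
          simp only [K]
          field_simp
  refine ⟨K, hK, fun a h => ?_⟩
  have hS : MeasurableSet ((fun p : ℝ≥0 × ℝ≥0 × Ω => p.1 + σ p.2.1 p.2.2) ⁻¹' Ioo a (a + h)) :=
    hm measurableSet_Ioo
  calc _ = W (Ioo a (a + h)) := by
        rw [Measure.map_apply hm measurableSet_Ioo, Measure.prod_apply hS]
        refine lintegral_congr fun v => ?_
        rw [Measure.prod_apply (measurable_prodMk_left hS)]
        rfl
    _ = ENNReal.ofReal K * lebesguePos (Ioo a (a + h)) := by rw [hW]; rfl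
    _ ≤ ENNReal.ofReal K * h := by gcongr; exact lebesguePos_Ioo_le a h
    _ = _ := by rw [ENNReal.ofReal_mul hK.le, ENNReal.ofReal_coe_nnreal]

end IsStableSubordinator

namespace IsStableRegenerativeLaw

variable {β : ℝ} {ν : Measure ClosedSubset}

lemma isProbabilityMeasure (hν : IsStableRegenerativeLaw β ν) : IsProbabilityMeasure ν := by
  obtain ⟨Ω, _, P, σ, hP, hσ, hlaw⟩ := hν
  exact hlaw.isProbabilityMeasure_iff.1 hP

lemma measure_zero_mem (hν : IsStableRegenerativeLaw β ν) :
    ν {F : ClosedSubset | 0 ∈ F.carrier} = 1 := by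
  obtain ⟨Ω, _, P, σ, hP, hσ, hlaw⟩ := hν
  rw [← hlaw.measure_eq ClosedSubset.measurableSet_zero_mem]
  convert measure_univ (μ := P)
  ext ω
  simp only [mem_ofPred_eq, mem_univ, iff_true]
  exact subset_closure ⟨0, hσ.zero ω⟩

/-- A hit of the interval is followed by expected occupation at least `κ h^β` of the interval of
length `2h`, whose total expected occupation is at most `2Kh`. Dividing gives the exponent `1 - β`.
-/
lemma exists_measure_hit_le (hν : IsStableRegenerativeLaw β ν) (hβ : β ∈ Ioo (0 : ℝ) 1) :
    ∃ C : ℝ, 0 < C ∧ ∀ a h : ℝ≥0, 0 < h →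
      (shiftMeasure β).prod ν {p | (shiftedSet p.1 p.2 ∩ Ioo a (a + h)).Nonempty} ≤
        ENNReal.ofReal (C * (h : ℝ) ^ (1 - β)) := by
  have := hν.isProbabilityMeasure
  obtain ⟨Ω, _, P, σ, hP, hσ, hlaw⟩ := hν
  obtain ⟨κ, hκ, hκle⟩ := hσ.exists_le_lintegral_measure_le
  obtain ⟨K, hK, hKle⟩ := hσ.exists_occupation_le hβ
  refine ⟨2 * K / κ, by positivity, fun a h hh => ?_⟩
  have hh' : (0 : ℝ) < h := hh
  set I := ∫⁻ s, P {ω | σ s ω ≤ h} ∂lebesguePos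
  have hpow : 0 < κ * (h : ℝ) ^ β := mul_pos hκ (Real.rpow_pos_of_pos hh' β)
  have hmeas := measurableSet_shiftedSet_hit (G := Ioo a (a + h)) isOpen_Ioo
  have hmul : (shiftMeasure β).prod ν {p | (shiftedSet p.1 p.2 ∩ Ioo a (a + h)).Nonempty} *
      ENNReal.ofReal (κ * (h : ℝ) ^ β) ≤ ENNReal.ofReal (K * (2 * h)) := by
    rw [Measure.prod_apply hmeas, ← lintegral_mul_const _ (measurable_measure_prodMk_left hmeas)]
    refine le_trans (lintegral_mono fun v => ?_) (hKle a (2 * h))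
    have hO : IsOpen {r : ℝ≥0 | v + r ∈ Ioo a (a + h)} := isOpen_Ioo.preimage (by fun_prop)
    have hhit : ν (Prod.mk v ⁻¹' {p | (shiftedSet p.1 p.2 ∩ Ioo a (a + h)).Nonempty}) =
        P {ω | ∃ t, σ t ω ∈ {r : ℝ≥0 | v + r ∈ Ioo a (a + h)}} := by
      have e : Prod.mk v ⁻¹' {p : ℝ≥0 × ClosedSubset |
          (shiftedSet p.1 p.2 ∩ Ioo a (a + h)).Nonempty} =
          {F : ClosedSubset | (F.carrier ∩ {r : ℝ≥0 | v + r ∈ Ioo a (a + h)}).Nonempty} := by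
        ext F
        exact shiftedSet_inter_nonempty_iff v F _
      rw [e, ← hlaw.measure_eq (ClosedSubset.measurableSet_hit hO)]
      congr 1
      ext ω
      simp only [ClosedSubset.closureRange, mem_ofPred_eq]
      rw [closure_inter_open_nonempty_iff hO]
      constructor
      · rintro ⟨_, ⟨t, rfl⟩, ht⟩
        exact ⟨t, ht⟩
      · rintro ⟨t, ht⟩
        exact ⟨_, ⟨t, rfl⟩, ht⟩
    rw [hhit]
    calc _ ≤ P {ω | ∃ t, σ t ω ∈ {r : ℝ≥0 | v + r ∈ Ioo a (a + h)}} * I := by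
          gcongr
          exact hκle h hh
      _ ≤ _ := hσ.measure_range_hit_mul_le (H' := {r | v + r ∈ Ioo a (a + 2 * h)}) hO ?_
    rintro r ⟨hr1, hr2⟩ s hs
    refine ⟨hr1.trans_le (by gcongr; exact le_self_add), ?_⟩
    calc v + (r + s) = (v + r) + s := by ring
      _ < (a + h) + h := add_lt_add_of_lt_of_le hr2 hs
      _ = a + 2 * h := by ring
  rw [← ENNReal.le_div_iff_mul_le (by simp [hpow]) (by simp),
    ← ENNReal.ofReal_div_of_pos hpow] at hmul
  refine hmul.trans_eq (congrArg _ ?_)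
  rw [Real.rpow_sub hh', Real.rpow_one]
  field_simp

end IsStableRegenerativeLaw

/-! ### Pointwise bound for `η` and a covering of the unit interval. -/

/-- At most one term exceeds `y₂`, and that one is at most `y₁`; fewer than `m` further terms are
nonzero, each at most `y₂`. -/
lemma etaFun_le {p : ℕ → ℝ≥0 × ℝ≥0 × ClosedSubset} {t : ℝ≥0} {m : ℕ} {y₁ y₂ : ℝ≥0}
    (hcard : ∀ s : Finset ℕ,
      (∀ j ∈ s, 0 < (p j).1 ∧ t ∈ shiftedSet (p j).2.1 (p j).2.2) → s.card < m)
    (h₁ : ∀ j, t ∈ shiftedSet (p j).2.1 (p j).2.2 → (p j).1 ≤ y₁)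
    (h₂ : ∀ i j, t ∈ shiftedSet (p i).2.1 (p i).2.2 → t ∈ shiftedSet (p j).2.1 (p j).2.2 →
      y₂ < (p i).1 → y₂ < (p j).1 → i = j) :
    etaFun p t ≤ y₁ + m * y₂ := by
  classical
  rw [etaFun, ENNReal.tsum_eq_iSup_sum]
  refine iSup_le fun s => ?_
  let s' := s.filter fun j => 0 < (p j).1 ∧ t ∈ shiftedSet (p j).2.1 (p j).2.2
  have hs' : ∀ j ∈ s', 0 < (p j).1 ∧ t ∈ shiftedSet (p j).2.1 (p j).2.2 :=
    fun j hj => (Finset.mem_filter.1 hj).2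
  have hsum : ∑ j ∈ s, (shiftedSet (p j).2.1 (p j).2.2).indicator
      (fun _ => ((p j).1 : ℝ≥0∞)) t = ∑ j ∈ s', ((p j).1 : ℝ≥0∞) := by
    rw [Finset.sum_filter]
    refine Finset.sum_congr rfl fun j _ => ?_
    by_cases ht : t ∈ shiftedSet (p j).2.1 (p j).2.2
    · rw [indicator_of_mem ht]
      split_ifs with h
      · rfl
      · simpa [ht] using h
    · rw [indicator_of_notMem ht, if_neg fun h => ht h.2]
  rw [hsum, ← Finset.sum_filter_add_sum_filter_not s' fun j => y₂ < (p j).1]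
  refine add_le_add ?_ ?_
  · have hone : (s'.filter fun j => y₂ < (p j).1).card ≤ 1 :=
      Finset.card_le_one.2 fun i hi j hj => by
        rw [Finset.mem_filter] at hi hj
        exact h₂ i j (hs' i hi.1).2 (hs' j hj.1).2 hi.2 hj.2
    calc _ ≤ (s'.filter fun j => y₂ < (p j).1).card • (y₁ : ℝ≥0∞) :=
          Finset.sum_le_card_nsmul _ _ _ fun j hj =>
            ENNReal.coe_le_coe.2 (h₁ j (hs' j (Finset.mem_filter.1 hj).1).2)
      _ ≤ 1 • (y₁ : ℝ≥0∞) := by gcongr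
      _ = y₁ := one_smul _ _
  · calc _ ≤ (s'.filter fun j => ¬ y₂ < (p j).1).card • (y₂ : ℝ≥0∞) :=
          Finset.sum_le_card_nsmul _ _ _ fun j hj =>
            ENNReal.coe_le_coe.2 (not_lt.1 (Finset.mem_filter.1 hj).2)
      _ ≤ m • (y₂ : ℝ≥0∞) := by
          gcongr
          exact (Finset.card_le_card (Finset.filter_subset _ _)).trans (hcard s' hs').le
      _ = m * y₂ := nsmul_eq_mul _ _

/-- The length `2/(n+1)`, twice the mesh, makes the open intervals overlap, so that grid points are
covered too. -/
lemma exists_mem_Ioo_div {t : ℝ≥0} (ht : t ∈ Ioo (0 : ℝ≥0) 1) (n : ℕ) :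
    ∃ k < n + 1, t ∈ Ioo ((k : ℝ≥0) / (n + 1)) (k / (n + 1) + 2 / (n + 1)) := by
  have hN : (0 : ℝ≥0) < (n : ℝ≥0) + 1 := by positivity
  have hpos : 0 < t * ((n : ℝ≥0) + 1) := mul_pos ht.1 hN
  have hc : 0 < ⌈t * ((n : ℝ≥0) + 1)⌉₊ := Nat.ceil_pos.2 hpos
  obtain ⟨k, hk⟩ := Nat.exists_eq_succ_of_ne_zero hc.ne'
  refine ⟨k, ?_, ?_, ?_⟩
  · have : ⌈t * ((n : ℝ≥0) + 1)⌉₊ ≤ n + 1 := by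
      rw [Nat.ceil_le]
      push_cast
      calc t * ((n : ℝ≥0) + 1) ≤ 1 * ((n : ℝ≥0) + 1) := by gcongr; exact ht.2.le
        _ = _ := one_mul _
    omega
  · rw [div_lt_iff₀ hN]
    exact Nat.lt_ceil.1 (by omega)
  · rw [← add_div, lt_div_iff₀ hN]
    calc t * ((n : ℝ≥0) + 1) ≤ (⌈t * ((n : ℝ≥0) + 1)⌉₊ : ℝ≥0) := Nat.le_ceil _
      _ = (k : ℝ≥0) + 1 := by rw [hk]; push_cast; rfl
      _ < k + 2 := by gcongr; norm_num

lemma card_le_pointCount {Ω E : Type*} {X : ℕ → Ω → E} {B : Set E} {ω : Ω} {s : Finset ℕ}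
    (hs : ∀ j ∈ s, X j ω ∈ B) : (s.card : ℕ∞) ≤ pointCount X B ω := by
  rw [← Set.encard_coe_eq_coe_finsetCard]
  exact Set.encard_le_encard fun j hj => hs j hj

/-! ### Overlaps of the shifted sets and two-sided tail bounds. -/

section Poisson

variable {α β : ℝ} {ν : Measure ClosedSubset} {Ω : Type*} [MeasurableSpace Ω] {P : Measure Ω}
  {X : ℕ → Ω → ℝ≥0 × ℝ≥0 × ClosedSubset}

lemma meanMeasure_Ioi_prod [SFinite ν] (hα : 0 < α) {x : ℝ≥0} (hx : 0 < x)
    (S : Set (ℝ≥0 × ClosedSubset)) :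
    meanMeasure α β ν (Ioi x ×ˢ S) =
      ENNReal.ofReal ((x : ℝ) ^ (-α)) * (shiftMeasure β).prod ν S := by
  rw [meanMeasure_eq, Measure.prod_prod, scaleMeasure_Ioi hα hx]

/-- No point of `(0, 1)` is covered by `m` shifted sets with marks above `ε`. -/
lemma measure_overlap_eq_zero (hα : 0 < α) (hβ : β ∈ Ioo (0 : ℝ) 1)
    (hν : IsStableRegenerativeLaw β ν) (hX : IsPoissonEnumeration X (meanMeasure α β ν) P)
    {m : ℕ} (hm : 1 < (1 - β) * m) {ε : ℝ≥0} (hε : 0 < ε) :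
    P {ω | ∃ t ∈ Ioo (0 : ℝ≥0) 1, ∃ s : Finset ℕ, (∀ j ∈ s, ε < (X j ω).1 ∧
      t ∈ shiftedSet (X j ω).2.1 (X j ω).2.2) ∧ m ≤ s.card} = 0 := by
  have := hν.isProbabilityMeasure
  obtain ⟨C, hC, hCle⟩ := hν.exists_measure_hit_le hβ
  have hε' : (0 : ℝ) < ε := hε
  let B : ℕ → ℕ → Set (ℝ≥0 × ℝ≥0 × ClosedSubset) := fun n k => Ioi ε ×ˢ
    {p | (shiftedSet p.1 p.2 ∩ Ioo ((k : ℝ≥0) / (n + 1)) (k / (n + 1) + 2 / (n + 1))).Nonempty}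
  have hB : ∀ n k, MeasurableSet (B n k) := fun n k =>
    measurableSet_Ioi.prod (measurableSet_shiftedSet_hit isOpen_Ioo)
  let A : ℝ := (ε : ℝ) ^ (-α) * (C * 2 ^ (1 - β))
  have hA : 0 < A := by positivity
  have hμB : ∀ n k, meanMeasure α β ν (B n k) ≤
      ENNReal.ofReal (A * ((n : ℝ) + 1) ^ (-(1 - β))) := by
    intro n k
    have hN : (0 : ℝ) < (n : ℝ) + 1 := by positivity
    rw [meanMeasure_Ioi_prod hα hε]
    calc _ ≤ ENNReal.ofReal ((ε : ℝ) ^ (-α)) *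
          ENNReal.ofReal (C * ((2 / ((n : ℝ≥0) + 1) : ℝ≥0) : ℝ) ^ (1 - β)) := by
          gcongr
          exact hCle _ _ (by positivity)
      _ = _ := by
          rw [← ENNReal.ofReal_mul (by positivity)]
          congr 1
          push_cast
          rw [Real.div_rpow (by norm_num) hN.le, Real.rpow_neg hN.le]
          simp only [A]
          ring
  -- Union bound over `n + 1` intervals, each hit `m` times with probability at most the `m`-th
  -- power of its mean measure. The exponent `(1-β)m - 1` is positive by `hm`, so the bound vanishes
  -- as `n → ∞`.
  have hbound : ∀ n : ℕ, P {ω | ∃ t ∈ Ioo (0 : ℝ≥0) 1, ∃ s : Finset ℕ, (∀ j ∈ s, ε < (X j ω).1 ∧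
      t ∈ shiftedSet (X j ω).2.1 (X j ω).2.2) ∧ m ≤ s.card} ≤
      ENNReal.ofReal (A ^ m * ((n : ℝ) + 1) ^ (-((1 - β) * m - 1))) := by
    intro n
    have hN : (0 : ℝ) < (n : ℝ) + 1 := by positivity
    calc _ ≤ P (⋃ k ∈ Finset.range (n + 1), {ω | m ≤ pointCount X (B n k) ω}) := by
          refine measure_mono ?_
          rintro ω ⟨t, ht, s, hs, hms⟩
          obtain ⟨k, hk, htk⟩ := exists_mem_Ioo_div ht n
          refine mem_iUnion₂.2 ⟨k, Finset.mem_range.2 hk, ?_⟩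
          refine le_trans (by exact_mod_cast hms) (card_le_pointCount (s := s) fun j hj => ?_)
          exact ⟨(hs j hj).1, t, (hs j hj).2, htk⟩
      _ ≤ ∑ k ∈ Finset.range (n + 1), P {ω | m ≤ pointCount X (B n k) ω} :=
          measure_biUnion_finset_le _ _
      _ ≤ ∑ k ∈ Finset.range (n + 1), ENNReal.ofReal (A * ((n : ℝ) + 1) ^ (-(1 - β))) ^ m := by
          refine Finset.sum_le_sum fun k _ => ?_
          refine (hX.measure_le_pointCount_le (hB n k)
            ((hμB n k).trans_lt ENNReal.ofReal_lt_top).ne m).trans ?_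
          gcongr
          exact hμB n k
      _ = _ := by
          rw [Finset.sum_const, Finset.card_range, nsmul_eq_mul,
            ← ENNReal.ofReal_pow (by positivity), ← ENNReal.ofReal_natCast,
            ← ENNReal.ofReal_mul (by positivity)]
          congr 1
          push_cast
          rw [mul_pow, ← Real.rpow_natCast (((n : ℝ) + 1) ^ (-(1 - β))), ← Real.rpow_mul hN.le,
            show -((1 - β) * m - 1) = 1 + -(1 - β) * m by ring, Real.rpow_add hN, Real.rpow_one]
          ring
  refine le_antisymm (ge_of_tendsto' (x := atTop) ?_ hbound) zero_le
  rw [← ENNReal.ofReal_zero]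
  refine ENNReal.tendsto_ofReal ?_
  rw [← mul_zero (A ^ m)]
  refine Tendsto.const_mul _ ?_
  exact (tendsto_rpow_neg_atTop (by linarith)).comp
    (tendsto_atTop_add_const_right _ 1 tendsto_natCast_atTop_atTop)

/-- Finitely many positive marks all exceed some `1/(n+1)`, so countably many null events suffice.
-/
lemma ae_card_overlap_lt (hα : 0 < α) (hβ : β ∈ Ioo (0 : ℝ) 1)
    (hν : IsStableRegenerativeLaw β ν) (hX : IsPoissonEnumeration X (meanMeasure α β ν) P)
    {m : ℕ} (hm : 1 < (1 - β) * m) :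
    ∀ᵐ ω ∂P, ∀ t ∈ Ioo (0 : ℝ≥0) 1, ∀ s : Finset ℕ,
      (∀ j ∈ s, 0 < (X j ω).1 ∧ t ∈ shiftedSet (X j ω).2.1 (X j ω).2.2) → s.card < m := by
  have h : ∀ᵐ ω ∂P, ∀ n : ℕ, ¬ ∃ t ∈ Ioo (0 : ℝ≥0) 1, ∃ s : Finset ℕ,
      (∀ j ∈ s, 1 / ((n : ℝ≥0) + 1) < (X j ω).1 ∧
        t ∈ shiftedSet (X j ω).2.1 (X j ω).2.2) ∧ m ≤ s.card := by
    refine ae_all_iff.2 fun n => ?_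
    rw [ae_iff]
    simpa only [not_not] using measure_overlap_eq_zero hα hβ hν hX hm
      (ε := 1 / ((n : ℝ≥0) + 1)) (by positivity)
  filter_upwards [h] with ω hω t ht s hs
  by_contra hcard
  have hev : ∀ᶠ n : ℕ in atTop, ∀ j ∈ s, 1 / ((n : ℝ≥0) + 1) < (X j ω).1 := by
    refine (Filter.eventually_all_finset s).2 fun j hj => ?_
    exact (tendsto_one_div_add_atTop_nhds_zero_nat (𝕜 := ℝ≥0)).eventually_lt_const (hs j hj).1
  obtain ⟨n, hn⟩ := hev.exists
  exact hω n ⟨t, ht, s, fun j hj => ⟨hn j hj, (hs j hj).2⟩, not_lt.1 hcard⟩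

/-- A shifted set reaching `t < 1` has `V < 1`. Off the null overlap event, having no such mark
above `y₁` and at most one above `y₂` keeps `η` below `x` by `etaFun_le`. -/
lemma measure_lt_etaSup_le (hα : 0 < α) (hβ : β ∈ Ioo (0 : ℝ) 1)
    (hν : IsStableRegenerativeLaw β ν) (hX : IsPoissonEnumeration X (meanMeasure α β ν) P)
    {m : ℕ} (hm : 1 < (1 - β) * m) {x y₁ y₂ : ℝ≥0} (h₁ : 0 < y₁) (h₂ : 0 < y₂)
    (hx : y₁ + m * y₂ ≤ x) :
    P {ω | (x : ℝ≥0∞) < etaSup (fun j => X j ω) (Ioo 0 1)} ≤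
      ENNReal.ofReal ((y₁ : ℝ) ^ (-α)) + ENNReal.ofReal ((y₂ : ℝ) ^ (-α)) ^ 2 := by
  have := hν.isProbabilityMeasure
  let B : ℝ≥0 → Set (ℝ≥0 × ℝ≥0 × ClosedSubset) := fun y => Ioi y ×ˢ (Iio 1 ×ˢ univ)
  have hB : ∀ y, MeasurableSet (B y) := fun y =>
    measurableSet_Ioi.prod (measurableSet_Iio.prod .univ)
  have hμB : ∀ y, 0 < y → meanMeasure α β ν (B y) = ENNReal.ofReal ((y : ℝ) ^ (-α)) := by
    intro y hy
    rw [meanMeasure_Ioi_prod hα hy, Measure.prod_prod, shiftMeasure_Iio_one hβ, measure_univ,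
      mul_one, mul_one]
  have hsub : {ω | (x : ℝ≥0∞) < etaSup (fun j => X j ω) (Ioo 0 1)} ⊆
      ({ω | (1 : ℕ) ≤ pointCount X (B y₁) ω} ∪ {ω | (2 : ℕ) ≤ pointCount X (B y₂) ω}) ∪
      {ω | ¬ ∀ t ∈ Ioo (0 : ℝ≥0) 1, ∀ s : Finset ℕ, (∀ j ∈ s, 0 < (X j ω).1 ∧
        t ∈ shiftedSet (X j ω).2.1 (X j ω).2.2) → s.card < m} := by
    intro ω hω
    by_contra hcon
    simp only [mem_union, mem_ofPred_eq, not_or, not_not, not_le] at hcon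
    obtain ⟨⟨hc1, hc2⟩, hc3⟩ := hcon
    refine not_lt.2 (iSup₂_le fun t ht => ?_) (show _ < etaSup (fun j => X j ω) (Ioo 0 1) from hω)
    have hV : ∀ j, t ∈ shiftedSet (X j ω).2.1 (X j ω).2.2 → (X j ω).2.1 < 1 := by
      rintro j ⟨r, -, hr⟩
      refine lt_of_le_of_lt ?_ ht.2
      rw [← hr]
      exact le_self_add
    refine (etaFun_le (hc3 t ht) (y₁ := y₁) (y₂ := y₂) ?_ ?_).trans (by exact_mod_cast hx)
    · intro j hj
      by_contra hlt
      have : ((({j} : Finset ℕ).card : ℕ) : ℕ∞) ≤ pointCount X (B y₁) ω :=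
        card_le_pointCount fun i hi => by
          rw [Finset.mem_singleton.1 hi]
          exact ⟨not_le.1 hlt, hV j hj, trivial⟩
      exact absurd hc1 (not_lt.2 (by simpa using this))
    · intro i j hi hj hyi hyj
      by_contra hij
      have : ((({i, j} : Finset ℕ).card : ℕ) : ℕ∞) ≤ pointCount X (B y₂) ω :=
        card_le_pointCount fun l hl => by
          rcases Finset.mem_insert.1 hl with rfl | hl
          · exact ⟨hyi, hV _ hi, trivial⟩
          · rw [Finset.mem_singleton.1 hl]
            exact ⟨hyj, hV _ hj, trivial⟩
      rw [Finset.card_pair hij] at this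
      exact absurd hc2 (not_lt.2 this)
  refine (measure_mono hsub).trans ((measure_union_le _ _).trans ?_)
  rw [ae_iff.1 (ae_card_overlap_lt hα hβ hν hX hm), add_zero]
  refine (measure_union_le _ _).trans (add_le_add ?_ ?_)
  · have := hX.measure_le_pointCount_le (hB y₁) (by rw [hμB _ h₁]; exact ENNReal.ofReal_ne_top) 1
    rwa [hμB _ h₁, pow_one] at this
  · have := hX.measure_le_pointCount_le (hB y₂) (by rw [hμB _ h₂]; exact ENNReal.ofReal_ne_top) 2
    rwa [hμB _ h₂] at this

/-- One point with `U > x`, `0 < V < 1` and `0 ∈ R` suffices, because `V` then lies in its own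
shifted set. The last two conditions leave the mean measure at `x^{-α}`. -/
lemma le_measureReal_lt_etaSup [IsProbabilityMeasure P] (hα : 0 < α) (hβ : β ∈ Ioo (0 : ℝ) 1)
    (hν : IsStableRegenerativeLaw β ν) (hX : IsPoissonEnumeration X (meanMeasure α β ν) P)
    {x : ℝ≥0} (hx : 0 < x) :
    1 - Real.exp (-((x : ℝ) ^ (-α))) ≤
      P.real {ω | (x : ℝ≥0∞) < etaSup (fun j => X j ω) (Ioo 0 1)} := by
  have := hν.isProbabilityMeasure
  let B : Set (ℝ≥0 × ℝ≥0 × ClosedSubset) := Ioi x ×ˢ (Ioo 0 1 ×ˢ {F | 0 ∈ F.carrier})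
  have hB : MeasurableSet B :=
    measurableSet_Ioi.prod (measurableSet_Ioo.prod ClosedSubset.measurableSet_zero_mem)
  have hμB : meanMeasure α β ν B = ENNReal.ofReal ((x : ℝ) ^ (-α)) := by
    rw [meanMeasure_Ioi_prod hα hx, Measure.prod_prod, shiftMeasure_Ioo_zero_one hβ,
      hν.measure_zero_mem, mul_one, mul_one]
  have hone := hX.measureReal_one_le_pointCount hB (by rw [hμB]; exact ENNReal.ofReal_ne_top)
  rw [hμB, ENNReal.toReal_ofReal (by positivity)] at hone
  rw [← hone]
  refine measureReal_mono fun ω hω => ?_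
  obtain ⟨j, hj⟩ := Set.one_le_encard_iff_nonempty.1 hω
  obtain ⟨hu, hv, h0⟩ : x < (X j ω).1 ∧ (X j ω).2.1 ∈ Ioo 0 1 ∧ 0 ∈ (X j ω).2.2.carrier := hj
  have hmem : (X j ω).2.1 ∈ shiftedSet (X j ω).2.1 (X j ω).2.2 := ⟨0, h0, add_zero _⟩
  calc (x : ℝ≥0∞) < (X j ω).1 := ENNReal.coe_lt_coe.2 hu
    _ = (shiftedSet (X j ω).2.1 (X j ω).2.2).indicator (fun _ => ((X j ω).1 : ℝ≥0∞))
        (X j ω).2.1 := by rw [indicator_of_mem hmem]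
    _ ≤ etaFun (fun j => X j ω) (X j ω).2.1 := ENNReal.le_tsum j
    _ ≤ _ := le_iSup₂ (f := fun t (_ : t ∈ Ioo (0 : ℝ≥0) 1) => etaFun (fun j => X j ω) t) _ hv

end Poisson

/-! ### Asymptotics. -/

lemma tendsto_div_of_tendsto_rpow_mul {f : ℝ → ℝ} {α : ℝ}
    (hf : Tendsto (fun x : ℝ => x ^ α * f x) atTop (𝓝 1)) {c : ℝ} (hc : 0 < c) :
    Tendsto (fun x => f (c * x) / f x) atTop (𝓝 (c ^ (-α))) := by
  have h1 : Tendsto (fun x => (c * x) ^ α * f (c * x)) atTop (𝓝 1) :=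
    hf.comp (tendsto_id.const_mul_atTop hc)
  have h2 := (h1.div hf one_ne_zero).const_mul (c ^ (-α))
  rw [div_one, mul_one] at h2
  refine h2.congr' ?_
  filter_upwards [eventually_gt_atTop 0] with x hx
  have hxα : x ^ α ≠ 0 := (Real.rpow_pos_of_pos hx α).ne'
  have hcα : c ^ α ≠ 0 := (Real.rpow_pos_of_pos hc α).ne'
  rw [Pi.div_apply, Real.mul_rpow hc.le hx.le, Real.rpow_neg hc.le, mul_assoc, mul_div_assoc,
    inv_mul_cancel_left₀ hcα, mul_div_mul_left _ _ hxα]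

lemma tendsto_upper_bound {α : ℝ} (hα : 0 < α) (M : ℝ) :
    Tendsto (fun x : ℝ => (1 - x ^ (-(1 / 4) : ℝ)) ^ (-α) + M * x ^ (-(α / 2))) atTop (𝓝 1) := by
  have h1 : Tendsto (fun x : ℝ => (1 - x ^ (-(1 / 4) : ℝ)) ^ (-α)) atTop (𝓝 1) := by
    have h := (tendsto_rpow_neg_atTop (by norm_num : (0 : ℝ) < 1 / 4)).const_sub 1
    have := h.rpow_const (p := -α) (Or.inl (by norm_num))
    simpa using this
  have h2 := (tendsto_rpow_neg_atTop (half_pos hα)).const_mul M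
  simpa using h1.add h2

theorem mainTheorem3 (α β : ℝ) (hα : 0 < α) (hβ : β ∈ Set.Ioo (0 : ℝ) 1)
    (ν : Measure ClosedSubset) (hν : IsStableRegenerativeLaw β ν)
    {Ω : Type*} [MeasurableSpace Ω] (P : Measure Ω) [IsProbabilityMeasure P]
    (X : ℕ → Ω → ℝ≥0 × ℝ≥0 × ClosedSubset)
    (hX : IsPoissonEnumeration X (meanMeasure α β ν) P) :
    Tendsto (fun x : ℝ =>
        x ^ α * P.real {ω | ENNReal.ofReal x < etaSup (fun j => X j ω) (Set.Ioo 0 1)})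
      atTop (𝓝 1) ∧
    ∀ c : ℝ, 0 < c →
      Tendsto (fun x : ℝ =>
          P.real {ω | ENNReal.ofReal (c * x) < etaSup (fun j => X j ω) (Set.Ioo 0 1)} /
            P.real {ω | ENNReal.ofReal x < etaSup (fun j => X j ω) (Set.Ioo 0 1)})
        atTop (𝓝 (c ^ (-α))) := by
  let f : ℝ → ℝ := fun x =>
    P.real {ω | ENNReal.ofReal x < etaSup (fun j => X j ω) (Set.Ioo 0 1)}
  suffices h : Tendsto (fun x : ℝ => x ^ α * f x) atTop (𝓝 1) from
    ⟨h, fun c hc => tendsto_div_of_tendsto_rpow_mul h hc⟩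
  have h1β : 0 < 1 - β := by linarith [hβ.2]
  obtain ⟨m, hm⟩ := exists_nat_gt (1 / (1 - β))
  rw [div_lt_iff₀' h1β] at hm
  have hm0 : (0 : ℝ) < m := by
    by_contra h
    nlinarith
  have hlow : Tendsto (fun x : ℝ => 1 / (1 + x ^ (-α))) atTop (𝓝 1) := by
    have := ((tendsto_rpow_neg_atTop hα).const_add 1).inv₀ (by norm_num)
    simpa using this
  refine tendsto_of_tendsto_of_tendsto_of_le_of_le' hlow
    (tendsto_upper_bound hα ((m : ℝ) ^ (2 * α))) ?_ ?_
  · filter_upwards [eventually_gt_atTop 0] with x hx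
    have hy : 0 < x ^ (-α) := Real.rpow_pos_of_pos hx _
    have hle := le_measureReal_lt_etaSup hα hβ hν hX (x := x.toNNReal) (Real.toNNReal_pos.2 hx)
    rw [Real.coe_toNNReal x hx.le] at hle
    have hexp : Real.exp (-(x ^ (-α))) ≤ 1 / (1 + x ^ (-α)) := by
      rw [Real.exp_neg, one_div]
      gcongr
      linarith [Real.add_one_le_exp (x ^ (-α))]
    calc 1 / (1 + x ^ (-α)) = x ^ α * (1 - 1 / (1 + x ^ (-α))) := by
          have : x ^ α * x ^ (-α) = 1 := by rw [← Real.rpow_add hx]; simp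
          field_simp
          linear_combination -this
      _ ≤ x ^ α * f x := by
          gcongr
          exact le_trans (by linarith) hle
  · filter_upwards [eventually_gt_atTop 1] with x hx
    have hx0 : 0 < x := one_pos.trans hx
    -- The split is `y₁ = (1-q)x`, `y₂ = qx/m`, so that `y₁ + m y₂ = x`. Any `q = x^{-θ}` with `0 <
    -- θ < 1/2` would do: `q → 0` gives `y₁ ~ x`, and `x^α y₂^{-2α}` is of order `x^{-α(1-2θ)}`.
    have hq : x ^ (-(1 / 4) : ℝ) < 1 := Real.rpow_lt_one_of_one_lt_of_neg hx (by norm_num)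
    have hq0 : 0 < x ^ (-(1 / 4) : ℝ) := Real.rpow_pos_of_pos hx0 _
    set q := x ^ (-(1 / 4) : ℝ) with hqdef
    have hy₁ : 0 < (1 - q) * x := mul_pos (by linarith) hx0
    have hy₂ : 0 < q * x / m := by positivity
    have hle := measure_lt_etaSup_le hα hβ hν hX hm (x := x.toNNReal)
      (y₁ := ((1 - q) * x).toNNReal) (y₂ := (q * x / m).toNNReal)
      (Real.toNNReal_pos.2 hy₁) (Real.toNNReal_pos.2 hy₂) (by
        rw [← NNReal.coe_le_coe]
        push_cast
        rw [Real.coe_toNNReal _ hy₁.le, Real.coe_toNNReal _ hy₂.le, Real.coe_toNNReal _ hx0.le]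
        refine le_of_eq ?_
        field_simp
        ring)
    rw [Real.coe_toNNReal _ hy₁.le, Real.coe_toNNReal _ hy₂.le,
      ← ENNReal.ofReal_pow (by positivity),
      ← ENNReal.ofReal_add (by positivity) (by positivity)] at hle
    have hreal : f x ≤ ((1 - q) * x) ^ (-α) + ((q * x / m) ^ (-α)) ^ 2 :=
      ENNReal.toReal_le_of_le_ofReal (by positivity) hle
    calc x ^ α * f x ≤ x ^ α * (((1 - q) * x) ^ (-α) + ((q * x / m) ^ (-α)) ^ 2) := by gcongr
      _ = (1 - q) ^ (-α) + (m : ℝ) ^ (2 * α) * x ^ (-(α / 2)) := by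
          rw [mul_add]
          congr 1
          · rw [Real.mul_rpow (by linarith) hx0.le, mul_left_comm, ← Real.rpow_add hx0]
            simp
          · have hqx : q * x = x ^ (3 / 4 : ℝ) := by
              rw [hqdef, ← Real.rpow_add_one hx0.ne']
              norm_num
            rw [hqx, Real.div_rpow (by positivity) hm0.le, ← Real.rpow_mul hx0.le, div_pow,
              ← Real.rpow_natCast, ← Real.rpow_mul hx0.le, ← Real.rpow_natCast,
              ← Real.rpow_mul hm0.le, div_eq_mul_inv, ← Real.rpow_neg hm0.le, ← mul_assoc,
              ← Real.rpow_add hx0, mul_comm]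
            congr 2 <;> push_cast <;> ring
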